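/- For every integer $d\ge 1$, there exists a finite bipartite graph of average degree at least $d$ that does not contain (as a not necessarily induced subgraph, up to isomorphism) the $1$-subdivision of any graph with Hall ratio greater than $18$. All graphs are finite and simple. The $1$-subdivision of a graph is obtained by subdividing each edge exactly once, and the Hall ratio of a graph $H$ is the maximum of $|V(K)|/\alpha(K)$ over all non-empty subgraphs $K$ of $H$, where $\alpha(K)$ is the maximum size of an independent set of $K$. -/

import Mathlib

namespace SimpleGraph

/-- The average degree of a finite graph: the mean of the degrees of its vertices. -/
noncomputable def averageDegree {V : Type*} [Fintype V] (G : SimpleGraph V)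
    [DecidableRel G.Adj] : ℝ :=
  (∑ v : V, (G.degree v : ℝ)) / (Fintype.card V : ℝ)

/-- Adjacency in the `1`-subdivision of `G`: the branch vertices are the vertices of `G`, the
subdivision vertices are the edges of `G`, and a branch vertex `v` is joined to a subdivision
vertex `e` exactly when `v` is an end of `e`. -/
def OneSubdivisionAdj {V : Type*} (G : SimpleGraph V) :
    V ⊕ G.edgeSet → V ⊕ G.edgeSet → Prop
  | Sum.inl v, Sum.inr e => v ∈ (e : Sym2 V)
  | Sum.inr e, Sum.inl v => v ∈ (e : Sym2 V)
  | Sum.inl _, Sum.inl _ => False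
  | Sum.inr _, Sum.inr _ => False

/-- The `1`-subdivision (incidence graph) of `G`. -/
def oneSubdivision {V : Type*} (G : SimpleGraph V) : SimpleGraph (V ⊕ G.edgeSet) where
  Adj := G.OneSubdivisionAdj
  symm := ⟨by rintro (v | e) (w | f) h <;> exact h⟩
  loopless := ⟨by rintro (v | e) h <;> exact h⟩

/-- The Hall ratio of a finite graph `G`: the maximum of `|V(K)| / α(K)` over all subgraphs `K`
of `G`. The empty subgraph contributes the value `0`. -/
noncomputable def hallRatio {V : Type*} [Finite V] (G : SimpleGraph V) : ℝ :=
  ⨆ K : G.Subgraph, (Nat.card K.verts : ℝ) / (K.coe.indepNum : ℝ)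

/-- The supremum in the definition of the Hall ratio is a maximum. -/
theorem hallRatio_isGreatest {V : Type*} [Finite V] (G : SimpleGraph V) :
    IsGreatest (Set.range fun K : G.Subgraph =>
      (Nat.card K.verts : ℝ) / (K.coe.indepNum : ℝ)) G.hallRatio := by
  have hfin : Finite G.Subgraph := by
    refine Finite.of_injective (fun K : G.Subgraph => (K.verts, K.Adj)) ?_
    intro K L h
    simp only [Prod.mk.injEq] at h
    exact Subgraph.ext h.1 h.2
  exact ⟨Set.Nonempty.csSup_mem (Set.range_nonempty _) (Set.finite_range _),
    fun x hx => le_csSup (Set.finite_range _).bddAbove hx⟩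

end SimpleGraph

/-!
The graph is random. One side is split into layers whose sizes `n 0, n 1, …` decrease very rapidly;
the other side has `n 0` vertices, each of which chooses one random neighbor in every layer. With
`3 * d` layers the average degree is at least `d`. A union bound shows that, with positive
probability, for every `j` the graph spanned by the other side and the layers before the `j`-th is
locally sparse at the scale `10 * n j`: on either side, any `r ≤ 10 * n j` vertices leave at most
`2 * r` vertices with two or more neighbors among them.

Let the graph contain the `1`-subdivision of `H`, with all branch vertices on one side, and take the
scale `j` for which the number `s` of branch vertices is at most `10 * n j` but exceeds
`10 * n (j + 1)`. If the branch vertices are the choosing vertices, at most `2 * s` edges of `H` are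
subdivided in the layers before the `j`-th by local sparsity, at most `s` in the `j`-th layer since
a vertex has only one neighbor there, and at most `s / 9` in the later layers, which are too small;
so Turán's theorem gives an independent set of size at least `s / 8`. If the branch vertices lie in
the layers, the same three cases apply to the vertices of `H` instead: those before the `j`-th layer
span a sparse graph, those in the `j`-th layer are pairwise nonadjacent, and those after it are few.

In general the branch vertices lie on both sides, but no edge of `H` joins branch vertices on
different sides, so that the independent sets found on the two sides can be united. As the argument
applies to every subgraph of `H`, its Hall ratio is at most `8`.
-/

open Finset SimpleGraph

section IndependentSets

variable {V : Type*}

theorem card_sq_le_indepNum_mul [Fintype V] (G : SimpleGraph V) [DecidableRel G.Adj] :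
    Fintype.card V ^ 2 ≤ G.indepNum * (Fintype.card V + 2 * #G.edgeFinset) := by
  classical
  have hfree : Gᶜ.CliqueFree (G.indepNum + 1) := by
    rw [cliqueFree_compl]
    intro s hs
    exact absurd hs.isIndepSet.card_le_indepNum (by rw [hs.card_eq]; omega)
  have hcompl : 2 * G.indepNum * #Gᶜ.edgeFinset ≤ (G.indepNum - 1) * Fintype.card V ^ 2 :=
    (Nat.mul_le_mul_left _ (hfree.card_edgeFinset_le.trans_eq
      card_edgeFinset_turanGraph.symm)).trans mul_card_edgeFinset_turanGraph_le
  have hdegree : ∀ v, Gᶜ.degree v + G.degree v + 1 = Fintype.card V := fun v => by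
    have := G.degree_lt_card_verts v
    rw [degree_compl]
    omega
  have hedges : 2 * #Gᶜ.edgeFinset + 2 * #G.edgeFinset + Fintype.card V = Fintype.card V ^ 2 := by
    rw [← sum_degrees_eq_twice_card_edges, ← sum_degrees_eq_twice_card_edges, sq,
      ← sum_add_distrib, Fintype.card_eq_sum_ones, ← sum_add_distrib, sum_mul]
    simp [hdegree]
  rcases Nat.eq_zero_or_pos G.indepNum with h | h
  · rcases isEmpty_or_nonempty V with _ | ⟨⟨v⟩⟩
    · simp
    · have := IsIndepSet.card_le_indepNum (G := G) (t := {v}) (by simp)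
      simp [h] at this
  · obtain ⟨a, ha⟩ := Nat.exists_eq_add_of_le' h
    rw [ha] at hcompl ⊢
    rw [Nat.add_sub_cancel] at hcompl
    nlinarith

theorem mul_card_le_mul_indepNum [Fintype V] (G : SimpleGraph V) [DecidableRel G.Adj] {p q : ℕ}
    (h : q * #G.edgeFinset ≤ p * Fintype.card V) :
    q * Fintype.card V ≤ (q + 2 * p) * G.indepNum := by
  rcases Nat.eq_zero_or_pos (Fintype.card V) with hV | hV
  · simp [hV]
  refine Nat.le_of_mul_le_mul_right ?_ hV
  calc q * Fintype.card V * Fintype.card V = q * Fintype.card V ^ 2 := by ring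
    _ ≤ q * (G.indepNum * (Fintype.card V + 2 * #G.edgeFinset)) :=
      Nat.mul_le_mul_left _ (card_sq_le_indepNum_mul G)
    _ = G.indepNum * (q * Fintype.card V + 2 * (q * #G.edgeFinset)) := by ring
    _ ≤ G.indepNum * (q * Fintype.card V + 2 * (p * Fintype.card V)) := by gcongr
    _ = (q + 2 * p) * G.indepNum * Fintype.card V := by ring

theorem exists_isIndepSet_subset_card_eq_indepNum_induce (G : SimpleGraph V) (s : Set V) :
    ∃ I : Finset V, ↑I ⊆ s ∧ G.IsIndepSet I ∧ #I = (G.induce s).indepNum := by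
  obtain ⟨J, hJ⟩ := (G.induce s).exists_isNIndepSet_indepNum
  refine ⟨J.map (Function.Embedding.subtype _), by simp, ?_, by simp [hJ.card_eq]⟩
  rw [coe_map]
  exact (Subtype.val_injective.injOn.pairwise_image (r := fun v w => ¬ G.Adj v w)).2 hJ.isIndepSet

theorem indepNum_induce_le [Finite V] (G : SimpleGraph V) (s : Set V) :
    (G.induce s).indepNum ≤ G.indepNum := by
  obtain ⟨I, -, hI, hcard⟩ := exists_isIndepSet_subset_card_eq_indepNum_induce G s
  exact hcard ▸ hI.card_le_indepNum

theorem indepNum_induce_add_indepNum_induce_compl_le [Finite V] (G : SimpleGraph V) {s : Set V}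
    (h : ∀ v ∈ s, ∀ w ∉ s, ¬ G.Adj v w) :
    (G.induce s).indepNum + (G.induce sᶜ).indepNum ≤ G.indepNum := by
  classical
  obtain ⟨I, hIs, hI, hIcard⟩ := exists_isIndepSet_subset_card_eq_indepNum_induce G s
  obtain ⟨J, hJs, hJ, hJcard⟩ := exists_isIndepSet_subset_card_eq_indepNum_induce G sᶜ
  have hdisj : Disjoint I J :=
    disjoint_coe.1 (disjoint_compl_right.mono hIs hJs)
  have hunion : G.IsIndepSet (I ∪ J : Finset V) := by
    rw [coe_union]
    exact Set.pairwise_union.2 ⟨hI, hJ, fun v hv w hw _ =>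
      ⟨h v (hIs hv) w (hJs hw), fun hwv => h v (hIs hv) w (hJs hw) hwv.symm⟩⟩
  rw [← hIcard, ← hJcard, ← card_union_of_disjoint hdisj]
  exact hunion.card_le_indepNum

end IndependentSets

section RelGraph

variable {X Y : Type*}

/-- The bipartite graph of a relation: its parts are the domain and the codomain of the relation,
and its edges are the related pairs. The graph of the theorem has this form. -/
def relGraph (R : X → Y → Prop) : SimpleGraph (X ⊕ Y) where
  Adj
    | Sum.inl x, Sum.inr y => R x y
    | Sum.inr y, Sum.inl x => R x y
    | Sum.inl _, Sum.inl _ => False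
    | Sum.inr _, Sum.inr _ => False
  symm := ⟨by rintro (x | y) (x' | y') h <;> exact h⟩
  loopless := ⟨by rintro (x | y) h <;> exact h⟩

theorem relGraph_adj_isLeft_iff {R : X → Y → Prop} {u v : X ⊕ Y} (h : (relGraph R).Adj u v) :
    v.isLeft ↔ u.isRight := by
  rcases u with x | y <;> rcases v with x' | y'
  · exact h.elim
  · simp
  · simp
  · exact h.elim

theorem isBipartite_relGraph (R : X → Y → Prop) : (relGraph R).IsBipartite :=
  ⟨Coloring.mk (fun v => if v.isLeft then 0 else 1) fun {u v} h => by
    have := relGraph_adj_isLeft_iff h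
    rcases u with x | y <;> rcases v with x' | y' <;> simp_all⟩

/-- The isomorphism exchanging the two parts of the bipartite graph of a relation. -/
def relGraphSwap (R : X → Y → Prop) : relGraph R ≃g relGraph (flip R) where
  toEquiv := Equiv.sumComm X Y
  map_rel_iff' := by rintro (x | y) (x' | y') <;> exact Iff.rfl

theorem mul_card_le_averageDegree_mul [Fintype X] [Fintype Y] [Nonempty X] (R : X → Y → Prop)
    [∀ x, DecidablePred (R x)] [DecidableRel (relGraph R).Adj] {k : ℕ}
    (hk : ∀ x, k ≤ #{y | R x y}) :
    (k * Fintype.card X : ℝ) ≤ (relGraph R).averageDegree * (Fintype.card X + Fintype.card Y) := by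
  have hdegree : ∀ x, (relGraph R).degree (Sum.inl x) = #{y | R x y} := by
    intro x
    rw [← card_neighborFinset_eq_degree,
      ← card_map (s := {y | R x y}) (Function.Embedding.inr : Y ↪ X ⊕ Y)]
    congr 1
    ext (x' | y) <;> simp only [mem_neighborFinset] <;> simp [relGraph]
  have hsum : k * Fintype.card X ≤ ∑ v, (relGraph R).degree v :=
    calc k * Fintype.card X = ∑ _x : X, k := by simp [mul_comm]
      _ ≤ ∑ x, (relGraph R).degree (Sum.inl x) := sum_le_sum fun x _ => hdegree x ▸ hk x
      _ ≤ ∑ v, (relGraph R).degree v := by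
        rw [Fintype.sum_sum_type]
        exact Nat.le_add_right _ _
  have hcard : (Fintype.card (X ⊕ Y) : ℝ) = Fintype.card X + Fintype.card Y := by
    rw [Fintype.card_sum, Nat.cast_add]
  rw [averageDegree, ← hcard, div_mul_cancel₀ _ (by positivity)]
  exact_mod_cast hsum

end RelGraph

/-- A model of the `1`-subdivision of `H` in the relation `R`: a copy of it in `relGraph R` all of
whose branch vertices lie in the domain of `R`, and hence all of whose subdivision vertices lie in
its codomain. -/
structure SubdivisionModel {W X Y : Type*} (H : SimpleGraph W) (R : X → Y → Prop) where
  branch : W ↪ X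
  sub : H.edgeSet ↪ Y
  rel : ∀ {v : W} {e : H.edgeSet}, v ∈ (e : Sym2 W) → R (branch v) (sub e)

section SubdivisionModel

variable {V W X Y : Type*} {H : SimpleGraph W} {R : X → Y → Prop}

/-- The restriction of a model to an induced subgraph. -/
def SubdivisionModel.induce (σ : SubdivisionModel H R) (s : Set W) :
    SubdivisionModel (H.induce s) R where
  branch := (Function.Embedding.subtype _).trans σ.branch
  sub := (Embedding.induce s).mapEdgeSet.trans σ.sub
  rel hv := σ.rel (Sym2.mem_map.2 ⟨_, hv, rfl⟩)

/-- The copy of the `1`-subdivision of `G` in that of `H` induced by a copy of `G` in `H`. -/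
def copyOneSubdivision {G : SimpleGraph V} (φ : Copy G H) :
    Copy G.oneSubdivision H.oneSubdivision where
  toHom :=
    { toFun := Sum.map φ φ.toHom.mapEdgeSet
      map_rel' := by
        rintro (v | e) (w | e') h
        · exact h.elim
        · exact Sym2.mem_map.2 ⟨v, h, rfl⟩
        · exact Sym2.mem_map.2 ⟨w, h, rfl⟩
        · exact h.elim }
  injective' := φ.injective.sumMap (Hom.mapEdgeSet.injective _ φ.injective)

theorem nonempty_subdivisionModel_of_isLeft (φ : Copy H.oneSubdivision (relGraph R))
    (h : ∀ v, (φ (Sum.inl v)).isLeft) : Nonempty (SubdivisionModel H R) := by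
  have hadj {v : W} {e : H.edgeSet} (hv : v ∈ (e : Sym2 W)) :
      (relGraph R).Adj (φ (Sum.inl v)) (φ (Sum.inr e)) := φ.toHom.map_adj hv
  have hsub (e : H.edgeSet) : (φ (Sum.inr e)).isRight :=
    (relGraph_adj_isLeft_iff (hadj (Sym2.out_fst_mem (e : Sym2 W))).symm).1 (h _)
  choose x hx using fun v => Sum.isLeft_iff.1 (h v)
  choose y hy using fun e => Sum.isRight_iff.1 (hsub e)
  refine ⟨⟨⟨x, fun v w hvw => ?_⟩, ⟨y, fun e e' hee' => ?_⟩, fun {v e} hv => ?_⟩⟩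
  · exact Sum.inl_injective (φ.injective ((hx v).trans ((congrArg _ hvw).trans (hx w).symm)))
  · exact Sum.inr_injective (φ.injective ((hy e).trans ((congrArg _ hee').trans (hy e').symm)))
  · have := hadj hv
    rwa [hx, hy] at this

theorem nonempty_subdivisionModel_induce (φ : Copy H.oneSubdivision (relGraph R)) :
    Nonempty (SubdivisionModel (H.induce {v | (φ (Sum.inl v)).isLeft}) R) :=
  nonempty_subdivisionModel_of_isLeft
    (φ.comp (copyOneSubdivision (Embedding.induce {v | (φ (Sum.inl v)).isLeft}).toCopy))
    fun v => v.2

theorem card_le_mul_indepNum_of_isContained [Finite W] {c : ℕ}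
    (hR : ∀ s : Set W, SubdivisionModel (H.induce s) R → Nat.card s ≤ c * (H.induce s).indepNum)
    (hflip : ∀ s : Set W, SubdivisionModel (H.induce s) (flip R) →
      Nat.card s ≤ c * (H.induce s).indepNum)
    (h : H.oneSubdivision ⊑ relGraph R) : Nat.card W ≤ c * H.indepNum := by
  obtain ⟨φ⟩ := h
  set s : Set W := {v | (φ (Sum.inl v)).isLeft}
  obtain ⟨σ⟩ := nonempty_subdivisionModel_induce φ
  have hleft := hR s σ
  have hright : Nat.card ↥sᶜ ≤ c * (H.induce sᶜ).indepNum := by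
    have hcompl : {v | ((relGraphSwap R).toCopy.comp φ (Sum.inl v)).isLeft} = sᶜ := by
      ext v
      change (φ (Sum.inl v)).swap.isLeft ↔ ¬ (φ (Sum.inl v)).isLeft
      simp
    obtain ⟨τ⟩ := nonempty_subdivisionModel_induce ((relGraphSwap R).toCopy.comp φ)
    exact hcompl ▸ hflip _ τ
  have hcross : ∀ v ∈ s, ∀ w ∉ s, ¬ H.Adj v w := by
    intro v hv w hw hvw
    have hadj {u : W} (hu : u ∈ s(v, w)) :
        (relGraph R).Adj (φ (Sum.inr ⟨s(v, w), hvw⟩)) (φ (Sum.inl u)) :=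
      φ.toHom.map_adj (v := Sum.inr ⟨s(v, w), hvw⟩) (w := Sum.inl u) hu
    exact hw ((relGraph_adj_isLeft_iff (hadj (Sym2.mem_mk_right v w))).2
      ((relGraph_adj_isLeft_iff (hadj (Sym2.mem_mk_left v w))).1 hv))
  calc Nat.card W = Nat.card s + Nat.card ↥sᶜ := by
        simpa only [Nat.card_coe_set_eq] using (Set.ncard_add_ncard_compl s).symm
    _ ≤ c * ((H.induce s).indepNum + (H.induce sᶜ).indepNum) := by
        rw [mul_add]
        exact Nat.add_le_add hleft hright
    _ ≤ c * H.indepNum :=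
        Nat.mul_le_mul_left c (indepNum_induce_add_indepNum_induce_compl_le H hcross)

end SubdivisionModel

theorem hallRatio_le_of_forall_card_le {V : Type*} {W : Type*} [Finite W] {G : SimpleGraph V}
    {H : SimpleGraph W} {c : ℕ}
    (hG : ∀ K : H.Subgraph, K.coe.oneSubdivision ⊑ G → Nat.card K.verts ≤ c * K.coe.indepNum)
    (h : H.oneSubdivision ⊑ G) : H.hallRatio ≤ c := by
  obtain ⟨K, hK⟩ := (hallRatio_isGreatest H).1
  rw [← hK]
  refine div_le_of_le_mul₀ (Nat.cast_nonneg _) (Nat.cast_nonneg _) ?_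
  exact_mod_cast hG K (.trans ⟨copyOneSubdivision K.coeCopy⟩ h)

section RandomRelations

variable {ι Ω X Y : Type*}

theorem card_biUnion_mul_le [DecidableEq Ω] (s : Finset ι) (F : ι → Finset Ω) {Q N : ℕ}
    (h : ∀ i ∈ s, #(F i) * Q ≤ N) : #(s.biUnion F) * Q ≤ #s * N :=
  calc #(s.biUnion F) * Q ≤ (∑ i ∈ s, #(F i)) * Q := Nat.mul_le_mul_right _ card_biUnion_le
    _ = ∑ i ∈ s, #(F i) * Q := sum_mul ..
    _ ≤ #s * N := sum_le_card_nsmul _ _ _ h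

open Classical in
theorem exists_forall_of_card_filter_not_mul_le [Fintype ι] [Fintype Ω] [Nonempty Ω]
    {P : ι → Ω → Prop} {m : ℕ} (hm : Fintype.card ι < m)
    (h : ∀ i, #{ω | ¬ P i ω} * m ≤ Fintype.card Ω) : ∃ ω, ∀ i, P i ω := by
  by_contra! hP
  have hcover : (univ : Finset Ω) = univ.biUnion fun i => {ω | ¬ P i ω} := by
    ext ω
    simpa using hP ω
  have hle := card_biUnion_mul_le univ _ fun i _ => h i
  rw [← hcover, card_univ, card_univ, mul_comm] at hle
  exact hm.not_ge (Nat.le_of_mul_le_mul_right hle Fintype.card_pos)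

theorem card_filter_prescribed_mul_pow_le [Fintype ι] [DecidableEq ι] {α : ι → Type*}
    [∀ i, Fintype (α i)] [∀ i, DecidableEq (α i)] {E : Finset (Σ i, α i)} {q : ℕ}
    (hq : ∀ p ∈ E, q ≤ Fintype.card (α p.1)) :
    #{f : ∀ i, α i | ∀ p ∈ E, f p.1 = p.2} * q ^ #E ≤ Fintype.card (∀ i, α i) := by
  rcases ({f : ∀ i, α i | ∀ p ∈ E, f p.1 = p.2} : Finset _).eq_empty_or_nonempty with h | ⟨f₀, hf₀⟩
  · simp [h]
  rw [mem_filter_univ] at hf₀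
  set I := E.image Sigma.fst
  have hE : #E = #I := by
    refine (card_image_of_injOn ?_).symm
    rintro ⟨i, a⟩ hp ⟨i', a'⟩ hp' (rfl : i = i')
    exact congrArg _ ((hf₀ _ hp).symm.trans (hf₀ _ hp'))
  have hsub : ({f : ∀ i, α i | ∀ p ∈ E, f p.1 = p.2} : Finset _) ⊆
      Fintype.piFinset fun i => if i ∈ I then {f₀ i} else univ := by
    intro f hf
    rw [mem_filter_univ] at hf
    rw [Fintype.mem_piFinset]
    intro i
    split_ifs with hi
    · obtain ⟨p, hp, rfl⟩ := mem_image.1 hi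
      rw [mem_singleton, hf p hp, hf₀ p hp]
    · exact mem_univ _
  have hpow : q ^ #E = ∏ i, if i ∈ I then q else 1 := by
    rw [hE, prod_ite_mem, univ_inter, prod_const]
  calc #{f : ∀ i, α i | ∀ p ∈ E, f p.1 = p.2} * q ^ #E
      ≤ (∏ i, #(if i ∈ I then {f₀ i} else univ)) * q ^ #E := by
        rw [← Fintype.card_piFinset]
        exact Nat.mul_le_mul_right _ (card_le_card hsub)
    _ ≤ ∏ i, Fintype.card (α i) := by
        rw [hpow, ← prod_mul_distrib]
        refine prod_le_prod' fun i _ => ?_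
        split_ifs with hi
        · obtain ⟨p, hp, rfl⟩ := mem_image.1 hi
          simpa using hq p hp
        · simp
    _ = Fintype.card (∀ i, α i) := Fintype.card_pi.symm

open Classical in
/-- A random relation, with `ω` uniform in `Ω`, is `q`-spread if any given set `E` of pairs is
related with probability at most `q⁻¹ ^ #E`. It replaces independence in union bounds. -/
def IsSpread [Fintype Ω] (R : Ω → X → Y → Prop) (q : ℕ) : Prop :=
  ∀ E : Finset (X × Y), #{ω | ∀ p ∈ E, R ω p.1 p.2} * q ^ #E ≤ Fintype.card Ω

theorem IsSpread.flip [Fintype Ω] {R : Ω → X → Y → Prop} {q : ℕ} (hR : IsSpread R q) :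
    IsSpread (fun ω => flip (R ω)) q := by
  classical
  intro E
  have hswap := hR (E.image Prod.swap)
  simp only [forall_mem_image, card_image_of_injective _ Prod.swap_injective] at hswap
  exact hswap

/-- Every element of `T` is related to at least two elements of `S`, as the image of a subdivision
vertex is to the images of the branch vertices. -/
def EachHasTwoNeighbors (R : X → Y → Prop) (S : Finset X) (T : Finset Y) : Prop :=
  ∀ t ∈ T, ∃ p ⊆ S, #p = 2 ∧ ∀ x ∈ p, R x t

/-- Some `u` elements of the codomain are each related to at least two of some `r` elements of the
domain. For `u = 2 * r` this is the event excluded by the union bound. -/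
def HasDenseIncidence (R : X → Y → Prop) (r u : ℕ) : Prop :=
  ∃ S T, #S = r ∧ #T = u ∧ EachHasTwoNeighbors R S T

variable [Fintype Ω] {R : Ω → X → Y → Prop} {q : ℕ}

open Classical in
theorem IsSpread.card_filter_eachHasTwoNeighbors_mul_pow_le (hR : IsSpread R q) (S : Finset X)
    (T : Finset Y) :
    #{ω | EachHasTwoNeighbors (R ω) S T} * q ^ (2 * #T) ≤ (#S ^ 2) ^ #T * Fintype.card Ω := by
  let G : Finset (T → Finset X) := Fintype.piFinset fun _ => S.powersetCard 2
  let E (g : T → Finset X) : Finset (X × Y) := univ.biUnion fun t => g t ×ˢ {t.1}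
  have hE : ∀ g ∈ G, #(E g) = 2 * #T := by
    intro g hg
    have hg' (t : T) : #(g t) = 2 := (mem_powersetCard.1 (Fintype.mem_piFinset.1 hg t)).2
    rw [card_biUnion fun t _ t' _ h => disjoint_product.2
      (Or.inr (disjoint_singleton.2 (Subtype.coe_injective.ne h)))]
    simp [hg', mul_comm]
  have hsub : ({ω | EachHasTwoNeighbors (R ω) S T} : Finset Ω) ⊆
      G.biUnion fun g => {ω | ∀ p ∈ E g, R ω p.1 p.2} := by
    intro ω hω
    choose g hgS hg2 hg using (mem_filter.1 hω).2
    refine mem_biUnion.2 ⟨fun t => g t t.2, Fintype.mem_piFinset.2 fun t =>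
      mem_powersetCard.2 ⟨hgS t t.2, hg2 t t.2⟩, (mem_filter_univ _).2 ?_⟩
    rintro ⟨x, y⟩ hxy
    obtain ⟨t, -, hxt⟩ := mem_biUnion.1 hxy
    obtain ⟨hx, hy⟩ := mem_product.1 hxt
    obtain rfl := mem_singleton.1 hy
    exact hg t t.2 x hx
  calc #{ω | EachHasTwoNeighbors (R ω) S T} * q ^ (2 * #T)
      ≤ #(G.biUnion fun g => {ω | ∀ p ∈ E g, R ω p.1 p.2}) * q ^ (2 * #T) :=
        Nat.mul_le_mul_right _ (card_le_card hsub)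
    _ ≤ #G * Fintype.card Ω := card_biUnion_mul_le _ _ fun g hg => hE g hg ▸ hR (E g)
    _ = (#S).choose 2 ^ #T * Fintype.card Ω := by
        simp only [G, Fintype.card_piFinset, card_powersetCard, prod_const, card_univ,
          Fintype.card_coe]
    _ ≤ (#S ^ 2) ^ #T * Fintype.card Ω := by
        gcongr
        exact Nat.choose_le_pow _ _

variable [Fintype X] [Fintype Y]

open Classical in
theorem IsSpread.card_filter_hasDenseIncidence_mul_pow_le (hR : IsSpread R q) (r u : ℕ) :
    #{ω | HasDenseIncidence (R ω) r u} * q ^ (2 * u) ≤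
      (Fintype.card X).choose r * ((Fintype.card Y).choose u *
        ((r ^ 2) ^ u * Fintype.card Ω)) := by
  have hcover : ({ω | HasDenseIncidence (R ω) r u} : Finset Ω) =
      (univ.powersetCard r).biUnion fun S => (univ.powersetCard u).biUnion fun T =>
        {ω | EachHasTwoNeighbors (R ω) S T} := by
    ext ω
    simp [HasDenseIncidence]
  rw [hcover, ← card_univ (α := X), ← card_univ (α := Y), ← card_powersetCard,
    ← card_powersetCard]
  refine card_biUnion_mul_le _ _ fun S hS => card_biUnion_mul_le _ _ fun T hT => ?_
  obtain rfl := mem_powersetCard_univ.1 hS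
  obtain rfl := mem_powersetCard_univ.1 hT
  exact hR.card_filter_eachHasTwoNeighbors_mul_pow_le S T

end RandomRelations

theorem pow_self_le_three_pow_mul_factorial (r : ℕ) : r ^ r ≤ 3 ^ r * r.factorial := by
  have hexp : (r : ℝ) ^ r / r.factorial ≤ 3 ^ r :=
    calc (r : ℝ) ^ r / r.factorial ≤ Real.exp r := Real.pow_div_factorial_le_exp r r.cast_nonneg r
      _ = Real.exp 1 ^ r := (Real.exp_one_pow r).symm
      _ ≤ 3 ^ r := pow_le_pow_left₀ (Real.exp_pos 1).le Real.exp_one_lt_three.le r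
  rw [div_le_iff₀ (by positivity)] at hexp
  exact_mod_cast hexp

theorem choose_mul_pow_self_le (m r : ℕ) : m.choose r * r ^ r ≤ (3 * m) ^ r :=
  calc m.choose r * r ^ r ≤ m.choose r * (3 ^ r * r.factorial) :=
        Nat.mul_le_mul_left _ (pow_self_le_three_pow_mul_factorial r)
    _ = 3 ^ r * (r.factorial * m.choose r) := by ring
    _ ≤ 3 ^ r * m ^ r := by
        rw [← Nat.descFactorial_eq_factorial_mul_choose]
        exact Nat.mul_le_mul_left _ (Nat.descFactorial_le_pow _ _)
    _ = (3 * m) ^ r := (mul_pow ..).symm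

theorem choose_mul_choose_mul_pow_le {a b n : ℕ} (ha : a ≤ 2 * n) (hb : b ≤ 2 * n) (r : ℕ) :
    a.choose r * b.choose (2 * r) * (r ^ 2) ^ (2 * r) ≤ (216 * n ^ 3 * r) ^ r := by
  have hchoose {m : ℕ} (hm : m ≤ 2 * n) (k : ℕ) : m.choose k * k ^ k ≤ (6 * n) ^ k :=
    (choose_mul_pow_self_le m k).trans (Nat.pow_le_pow_left (by omega) k)
  calc a.choose r * b.choose (2 * r) * (r ^ 2) ^ (2 * r)
      = a.choose r * r ^ r * (b.choose (2 * r) * r ^ (2 * r)) * r ^ r := by ring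
    _ ≤ a.choose r * r ^ r * (b.choose (2 * r) * (2 * r) ^ (2 * r)) * r ^ r := by
        gcongr
        omega
    _ ≤ (6 * n) ^ r * (6 * n) ^ (2 * r) * r ^ r := by
        gcongr
        exacts [hchoose ha r, hchoose hb (2 * r)]
    _ = (216 * n ^ 3 * r) ^ r := by
        rw [pow_mul, ← mul_pow, ← mul_pow]
        ring

/-- A relation is locally sparse up to size `s` if, for `r ≤ s`, any `r` elements of its domain
leave at most `2 * r` elements of its codomain with two or more neighbors among them. A graph on at
most `s` vertices whose `1`-subdivision has a model in it has at most twice as many edges as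
vertices. -/
def IsLocallySparse {X Y : Type*} (R : X → Y → Prop) (s : ℕ) : Prop :=
  ∀ S T, #S ≤ s → EachHasTwoNeighbors R S T → #T ≤ 2 * #S

section LocallySparse

variable {Ω W X Y : Type*}

theorem isLocallySparse_of_forall_not {R : X → Y → Prop} (h : ∀ x y, ¬ R x y) (s : ℕ) :
    IsLocallySparse R s := by
  intro S T _ hST
  have hT : T = ∅ := by
    refine eq_empty_of_forall_notMem fun t ht => ?_
    obtain ⟨p, -, hp, hpt⟩ := hST t ht
    obtain ⟨x, hx⟩ := card_pos.1 (hp ▸ two_pos)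
    exact h x t (hpt x hx)
  simp [hT]

theorem isLocallySparse_of_forall_not_hasDenseIncidence {R : X → Y → Prop} {s : ℕ}
    (h : ∀ r ∈ Ico 1 (s + 1), ¬ HasDenseIncidence R r (2 * r)) : IsLocallySparse R s := by
  intro S T hS hST
  by_contra! hT
  obtain ⟨T', hT'T, hT'⟩ := exists_subset_card_eq hT.le
  have hSpos : 0 < #S := by
    obtain ⟨t, ht⟩ := card_pos.1 (Nat.zero_lt_of_lt hT)
    obtain ⟨p, hpS, hp, -⟩ := hST t ht
    have := card_le_card hpS
    omega
  exact h #S (mem_Ico.2 ⟨hSpos, Nat.lt_succ_of_le hS⟩)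
    ⟨S, T', rfl, hT', fun t ht => hST t (hT'T ht)⟩

open Classical in
theorem IsSpread.card_filter_hasDenseIncidence_two_mul_mul_pow_le [Fintype Ω] [Fintype X]
    [Fintype Y] {R : Ω → X → Y → Prop} {n q Q r : ℕ} (hR : IsSpread R q)
    (hX : Fintype.card X ≤ 2 * n) (hY : Fintype.card Y ≤ 2 * n) (hn : 0 < n) (hr : 0 < r)
    (hq : Q * (216 * n ^ 3 * r) ≤ q ^ 4) :
    #{ω | HasDenseIncidence (R ω) r (2 * r)} * Q ^ r ≤ Fintype.card Ω := by
  refine Nat.le_of_mul_le_mul_right (c := (216 * n ^ 3 * r) ^ r) ?_ (by positivity)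
  calc #{ω | HasDenseIncidence (R ω) r (2 * r)} * Q ^ r * (216 * n ^ 3 * r) ^ r
      = #{ω | HasDenseIncidence (R ω) r (2 * r)} * (Q * (216 * n ^ 3 * r)) ^ r := by
        rw [mul_pow Q, mul_assoc]
    _ ≤ #{ω | HasDenseIncidence (R ω) r (2 * r)} * (q ^ 4) ^ r := by gcongr
    _ = #{ω | HasDenseIncidence (R ω) r (2 * r)} * q ^ (2 * (2 * r)) := by
        rw [← pow_mul]
        ring_nf
    _ ≤ _ := hR.card_filter_hasDenseIncidence_mul_pow_le r (2 * r)
    _ = (Fintype.card X).choose r * (Fintype.card Y).choose (2 * r) * (r ^ 2) ^ (2 * r) *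
        Fintype.card Ω := by ring
    _ ≤ (216 * n ^ 3 * r) ^ r * Fintype.card Ω :=
        Nat.mul_le_mul_right _ (choose_mul_choose_mul_pow_le hX hY r)
    _ = Fintype.card Ω * (216 * n ^ 3 * r) ^ r := mul_comm _ _

open Classical in
theorem IsSpread.card_filter_not_isLocallySparse_mul_le [Fintype Ω] [Fintype X] [Fintype Y]
    {R : Ω → X → Y → Prop} {m n q s : ℕ} (hR : IsSpread R q)
    (hX : Fintype.card X ≤ 2 * n) (hY : Fintype.card Y ≤ 2 * n) (hn : 0 < n)
    (hq : (m + 1) * (216 * n ^ 3 * s) ≤ q ^ 4) :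
    #{ω | ¬ IsLocallySparse (R ω) s} * m ≤ Fintype.card Ω := by
  rcases Nat.eq_zero_or_pos m with rfl | hm
  · simp
  have hsub : ({ω | ¬ IsLocallySparse (R ω) s} : Finset Ω) ⊆
      (Ico 1 (s + 1)).biUnion fun r => {ω | HasDenseIncidence (R ω) r (2 * r)} := by
    intro ω hω
    by_contra hdense
    exact (mem_filter.1 hω).2 (isLocallySparse_of_forall_not_hasDenseIncidence fun r hr h =>
      hdense (mem_biUnion.2 ⟨r, hr, (mem_filter_univ _).2 h⟩))
  have hcard : ∀ r ∈ Ico 1 (s + 1),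
      #{ω | HasDenseIncidence (R ω) r (2 * r)} ≤ Fintype.card Ω / (m + 1) ^ r := by
    intro r hr
    obtain ⟨hr1, hrs⟩ := mem_Ico.1 hr
    rw [Nat.le_div_iff_mul_le (by positivity)]
    exact hR.card_filter_hasDenseIncidence_two_mul_mul_pow_le hX hY hn hr1
      (le_trans (by gcongr; omega) hq)
  rw [← Nat.le_div_iff_mul_le hm]
  calc #{ω | ¬ IsLocallySparse (R ω) s}
      ≤ ∑ r ∈ Ico 1 (s + 1), #{ω | HasDenseIncidence (R ω) r (2 * r)} :=
        (card_le_card hsub).trans card_biUnion_le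
    _ ≤ ∑ r ∈ Ico 1 (s + 1), Fintype.card Ω / (m + 1) ^ r := sum_le_sum hcard
    _ ≤ Fintype.card Ω / m := Nat.geom_sum_Ico_le (by omega) _ _

theorem IsLocallySparse.card_le [Fintype W] {R : X → Y → Prop} {s : ℕ} (hR : IsLocallySparse R s)
    (hW : Fintype.card W ≤ s) {H : SimpleGraph W} (x : W ↪ X) (y : H.edgeSet ↪ Y)
    {D : Finset H.edgeSet} (h : ∀ e ∈ D, ∀ v ∈ (e : Sym2 W), R (x v) (y e)) :
    #D ≤ 2 * Fintype.card W := by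
  classical
  have htwo : EachHasTwoNeighbors R (univ.map x) (D.map y) := by
    intro t ht
    obtain ⟨e, he, rfl⟩ := mem_map.1 ht
    refine ⟨(e : Sym2 W).toFinset.map x, map_subset_map.2 (subset_univ _), ?_, ?_⟩
    · rw [card_map, Sym2.card_toFinset_of_not_isDiag _ (H.not_isDiag_of_mem_edgeSet e.2)]
    · intro x' hx'
      obtain ⟨v, hv, rfl⟩ := mem_map.1 hx'
      exact h e he v (Sym2.mem_toFinset.1 hv)
  simpa using hR _ _ (by simpa using hW) htwo

end LocallySparse

section LayerSizes

/-- Layer sizes decreasing so fast that `layerSize c K i ^ 4` exceeds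
`layerSize c K (i + 1) * layerSize c K 0 ^ 3` by a factor of at least `c`, for `i < K`. The
truncated subtraction makes all sizes from the `K`-th on equal to `1`. -/
def layerSize (c K i : ℕ) : ℕ := c ^ (4 ^ K - 4 ^ i)

variable {c K i : ℕ}

theorem layerSize_pos (hc : 0 < c) (K i : ℕ) : 0 < layerSize c K i := Nat.pow_pos hc

theorem layerSize_antitone (hc : 0 < c) (K : ℕ) : Antitone (layerSize c K) := fun _ _ hij =>
  Nat.pow_le_pow_right hc (Nat.sub_le_sub_left (Nat.pow_le_pow_right (by norm_num) hij) _)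

theorem mul_layerSize_succ_le (hc : 0 < c) (hi : i < K) :
    c * layerSize c K (i + 1) ≤ layerSize c K i := by
  have hpow : 4 ^ (i + 1) ≤ 4 ^ K := Nat.pow_le_pow_right (by norm_num) hi
  have hpos : 0 < 4 ^ i := by positivity
  rw [layerSize, layerSize, ← pow_succ']
  exact Nat.pow_le_pow_right hc (by omega)

theorem mul_layerSize_succ_mul_pow_le (hc : 0 < c) (hi : i < K) :
    c * (layerSize c K (i + 1) * layerSize c K 0 ^ 3) ≤ layerSize c K i ^ 4 := by
  have hpow : 4 ^ (i + 1) ≤ 4 ^ K := Nat.pow_le_pow_right (by norm_num) hi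
  have hpos : 0 < 4 ^ i := by positivity
  simp only [layerSize, ← pow_mul, ← pow_add, ← pow_succ']
  exact Nat.pow_le_pow_right hc (by omega)

variable {n : ℕ → ℕ}

theorem nine_mul_sum_Ico_le {a b : ℕ} (hab : a ≤ b) (hn : ∀ i < b, 10 * n (i + 1) ≤ n i) :
    9 * ∑ i ∈ Ico a b, n i + 10 * n b ≤ 10 * n a := by
  induction b, hab using Nat.le_induction with
  | base => simp
  | succ b hab ih =>
    rw [sum_Ico_succ_top hab]
    have := ih fun i hi => hn i (by omega)
    have := hn b (by omega)
    omega

theorem exists_scale (hn : ∀ i < K, 10 * n (i + 1) ≤ n i) {s : ℕ} (hs : s ≤ 10 * n 0) :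
    ∃ j ≤ K, s ≤ 10 * n j ∧ 9 * ∑ i ∈ Ico (j + 1) K, n i ≤ s := by
  set j := Nat.findGreatest (fun i => s ≤ 10 * n i) K with hj
  have hjK : j ≤ K := Nat.findGreatest_le K
  refine ⟨j, hjK, Nat.findGreatest_spec (P := fun i => s ≤ 10 * n i) K.zero_le hs, ?_⟩
  rcases hjK.eq_or_lt with h | h
  · simp [h]
  · have hsum := nine_mul_sum_Ico_le (Nat.succ_le_of_lt h) hn
    have hlt : ¬ s ≤ 10 * n (j + 1) :=
      Nat.findGreatest_is_greatest (P := fun i => s ≤ 10 * n i) (hj ▸ j.lt_succ_self) h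
    rw [Nat.succ_eq_add_one] at hsum
    omega

end LayerSizes

theorem card_filter_lt_add_card_filter_eq_add_card_filter_gt {α β : Type*} [LinearOrder β]
    (s : Finset α) (g : α → β) (b : β) :
    #{a ∈ s | g a < b} + #{a ∈ s | g a = b} + #{a ∈ s | b < g a} = #s := by
  classical
  have hle : #{a ∈ s | g a < b} + #{a ∈ s | g a = b} = #{a ∈ s | g a ≤ b} := by
    rw [← card_union_of_disjoint (disjoint_filter.2 fun a _ => ne_of_lt), ← filter_or]
    simp only [le_iff_lt_or_eq]
  rw [hle]
  simpa only [not_le] using card_filter_add_card_filter_not (s := s) (g · ≤ b)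

/-- The vertices of `K` layers of sizes `n 0, …, n (K - 1)`, one side of the random bipartite
graph. -/
abbrev LayerVertex (n : ℕ → ℕ) (K : ℕ) : Type := Σ i : Fin K, Fin (n i)

/-- A choice of one vertex in each of the `K` layers for each of `n 0` further vertices: the sample
space of the random bipartite graph. -/
abbrev LayerChoice (n : ℕ → ℕ) (K : ℕ) : Type := ∀ p : Fin (n 0) × Fin K, Fin (n p.2)

section Layers

variable {n : ℕ → ℕ} {K : ℕ}

theorem card_layerVertex_le (hn : ∀ i < K, 10 * n (i + 1) ≤ n i) :
    Fintype.card (LayerVertex n K) ≤ 2 * n 0 := by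
  have hsum := nine_mul_sum_Ico_le K.zero_le hn
  rw [← range_eq_Ico, ← Fin.sum_univ_eq_sum_range] at hsum
  simp only [Fintype.card_sigma, Fintype.card_fin]
  omega

theorem card_filter_lt_layer_le {α : Type*} [Fintype α] (g : α ↪ LayerVertex n K) (j : ℕ) :
    #{a | j < (g a).1.val} ≤ ∑ i ∈ Ico (j + 1) K, n i := by
  have hsub : ({a | j < (g a).1.val} : Finset α).map g ⊆
      ({i | j < i.val} : Finset (Fin K)).sigma fun _ => univ := by
    intro b hb
    obtain ⟨a, ha, rfl⟩ := mem_map.1 hb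
    simpa using ha
  calc #{a | j < (g a).1.val} ≤ ∑ i : Fin K with j < i.val, n i := by
        simpa using card_le_card hsub
    _ = ∑ i ∈ range K with j < i, n i := by
        rw [sum_filter, sum_filter, Fin.sum_univ_eq_sum_range fun i => if j < i then n i else 0]
    _ = ∑ i ∈ Ico (j + 1) K, n i := by
        congr 1
        ext i
        simp [and_comm]

namespace LayerChoice

/-- The vertex `b` is chosen by `a`: the edge relation of the random bipartite graph. -/
def Rel (f : LayerChoice n K) (a : Fin (n 0)) (b : LayerVertex n K) : Prop := f (a, b.1) = b.2

/-- The vertex `b` is chosen by `a` and lies in one of the first `j` layers: the part of the random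
bipartite graph that is sparse at the scale of layer `j`. -/
def RelBelow (f : LayerChoice n K) (j : ℕ) (a : Fin (n 0)) (b : LayerVertex n K) : Prop :=
  b.1.val < j ∧ f.Rel a b

/-- At the scale of each layer `j`, the relation between the choosing vertices and the layers before
the `j`-th is locally sparse on both sides: what the random choice is required to satisfy. -/
def IsSparse (f : LayerChoice n K) : Prop :=
  ∀ j ≤ K, IsLocallySparse (f.RelBelow j) (10 * n j) ∧
    IsLocallySparse (flip (f.RelBelow j)) (10 * n j)

variable {f : LayerChoice n K}

theorem Rel.eq_of_layer_eq {a : Fin (n 0)} {b b' : LayerVertex n K} (h : f.Rel a b)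
    (h' : f.Rel a b') (hbb' : b.1.val = b'.1.val) : b = b' := by
  obtain ⟨i, b⟩ := b
  obtain ⟨i', b'⟩ := b'
  obtain rfl : i = i' := Fin.ext hbb'
  exact congrArg _ (h.symm.trans h')

theorem le_card_filter_rel [∀ a, DecidablePred (f.Rel a)] (a : Fin (n 0)) :
    K ≤ #{b | f.Rel a b} := by
  have hinj : Function.Injective fun i : Fin K => (⟨i, f (a, i)⟩ : LayerVertex n K) :=
    fun i i' h => congrArg Sigma.fst h
  calc K = #(univ.map ⟨_, hinj⟩) := by simp
    _ ≤ #{b | f.Rel a b} := card_le_card fun b hb => by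
        obtain ⟨i, -, rfl⟩ := mem_map.1 hb
        exact (mem_filter_univ _).2 rfl

theorem le_three_mul_averageDegree (f : LayerChoice n K) [DecidableRel (relGraph f.Rel).Adj]
    (hpos : 0 < n 0) (hn : ∀ i < K, 10 * n (i + 1) ≤ n i) :
    (K : ℝ) ≤ 3 * (relGraph f.Rel).averageDegree := by
  classical
  have : Nonempty (Fin (n 0)) := ⟨⟨0, hpos⟩⟩
  have hcard : (Fintype.card (LayerVertex n K) : ℝ) ≤ 2 * n 0 := mod_cast card_layerVertex_le hn
  have hnonneg : 0 ≤ (relGraph f.Rel).averageDegree := by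
    unfold averageDegree
    positivity
  have hdegree := mul_card_le_averageDegree_mul f.Rel f.le_card_filter_rel
  rw [Fintype.card_fin] at hdegree
  refine le_of_mul_le_mul_right ?_ (Nat.cast_pos.2 hpos : (0 : ℝ) < n 0)
  calc (K : ℝ) * n 0
      ≤ (relGraph f.Rel).averageDegree * (n 0 + Fintype.card (LayerVertex n K)) := hdegree
    _ ≤ (relGraph f.Rel).averageDegree * (n 0 + 2 * n 0) := by gcongr
    _ = 3 * (relGraph f.Rel).averageDegree * n 0 := by ring

theorem isSpread_relBelow (hn : Antitone n) (i : ℕ) :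
    IsSpread (fun f : LayerChoice n K => f.RelBelow (i + 1)) (n i) := by
  classical
  intro E
  by_cases hE : ∀ p ∈ E, p.2.1.val < i + 1
  · have hinj : Function.Injective fun p : Fin (n 0) × LayerVertex n K =>
        (⟨(p.1, p.2.1), p.2.2⟩ : Σ p : Fin (n 0) × Fin K, Fin (n p.2)) := by
      rintro ⟨a, i, b⟩ ⟨a', i', b'⟩ h
      simp only [Sigma.mk.injEq, Prod.mk.injEq] at h
      obtain ⟨⟨rfl, rfl⟩, h⟩ := h
      rw [eq_of_heq h]
    have hq : ∀ p ∈ E.map ⟨_, hinj⟩, n i ≤ Fintype.card (Fin (n p.1.2)) := by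
      simp only [forall_mem_map, Fintype.card_fin]
      exact fun p hp => hn (Nat.lt_succ_iff.1 (hE p hp))
    have hle := card_filter_prescribed_mul_pow_le hq
    rw [card_map] at hle
    refine (Nat.mul_le_mul_right _ (card_le_card fun f hf => ?_)).trans hle
    simp only [mem_filter_univ, forall_mem_map] at hf ⊢
    exact fun p hp => (hf p hp).2
  · push Not at hE
    obtain ⟨p, hp, hpi⟩ := hE
    have hnone (f : LayerChoice n K) : ¬ ∀ p ∈ E, f.RelBelow (i + 1) p.1 p.2 :=
      fun h => hpi.not_gt (h p hp).1
    simp only [hnone, filter_false, card_empty, zero_mul, Nat.zero_le]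

theorem exists_isSparse (hpos : ∀ i, 0 < n i) (hanti : Antitone n)
    (hn : ∀ i < K, 10 * n (i + 1) ≤ n i)
    (hgrowth : ∀ i < K, 4320 * (K + 1) * (n (i + 1) * n 0 ^ 3) ≤ n i ^ 4) :
    ∃ f : LayerChoice n K, f.IsSparse := by
  classical
  have hA : Fintype.card (Fin (n 0)) ≤ 2 * n 0 := by rw [Fintype.card_fin]; omega
  have hB : Fintype.card (LayerVertex n K) ≤ 2 * n 0 := card_layerVertex_le hn
  have hq (i : Fin K) :
      (2 * K + 1 + 1) * (216 * n 0 ^ 3 * (10 * n (i + 1))) ≤ n i ^ 4 :=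
    (by ring : _ = 4320 * (K + 1) * (n (i + 1) * n 0 ^ 3)).trans_le (hgrowth i i.2)
  have : Nonempty (LayerChoice n K) := ⟨fun p => ⟨0, hpos _⟩⟩
  -- Each of the `2 * K` conditions fails with probability at most `1 / (2 * K + 1)`.
  obtain ⟨f, hf⟩ := exists_forall_of_card_filter_not_mul_le (m := 2 * K + 1)
    (P := Sum.elim
      (fun (i : Fin K) (f : LayerChoice n K) =>
        IsLocallySparse (f.RelBelow (i + 1)) (10 * n (i + 1)))
      (fun (i : Fin K) (f : LayerChoice n K) =>
        IsLocallySparse (flip (f.RelBelow (i + 1))) (10 * n (i + 1))))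
    (by simp; omega)
    (Sum.rec
      (fun i => (isSpread_relBelow hanti i).card_filter_not_isLocallySparse_mul_le
        hA hB (hpos 0) (hq i))
      (fun i => (isSpread_relBelow hanti i).flip.card_filter_not_isLocallySparse_mul_le
        hB hA (hpos 0) (hq i)))
  refine ⟨f, fun j hj => ?_⟩
  cases j with
  | zero =>
    have hnone (a b) : ¬ f.RelBelow 0 a b := fun h => Nat.not_lt_zero _ h.1
    exact ⟨isLocallySparse_of_forall_not hnone _,
      isLocallySparse_of_forall_not (fun b a => hnone a b) _⟩
  | succ i => exact ⟨hf (Sum.inl ⟨i, hj⟩), hf (Sum.inr ⟨i, hj⟩)⟩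

variable {W : Type*} {H : SimpleGraph W}

theorem card_filter_layer_eq_le [Fintype W] [Fintype H.edgeSet] (σ : SubdivisionModel H f.Rel)
    (j : ℕ) : #{e | (σ.sub e).1.val = j} ≤ Fintype.card W := by
  refine card_le_card_of_injOn (fun e => (Quot.out (e : Sym2 W)).1) (fun _ _ => mem_univ _) ?_
  intro e he e' he' (hee' : (Quot.out (e : Sym2 W)).1 = (Quot.out (e' : Sym2 W)).1)
  have hrel := σ.rel (Sym2.out_fst_mem (e : Sym2 W))
  have hrel' := σ.rel (Sym2.out_fst_mem (e' : Sym2 W))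
  rw [← hee'] at hrel'
  exact σ.sub.injective (hrel.eq_of_layer_eq hrel'
    (((mem_filter_univ _).1 he).trans ((mem_filter_univ _).1 he').symm))

theorem isIndepSet_layer_eq (σ : SubdivisionModel H (flip f.Rel)) (j : ℕ) :
    H.IsIndepSet {v | (σ.branch v).1.val = j} := by
  intro v hv w hw hvw hadj
  have hrelv : f.Rel (σ.sub ⟨s(v, w), hadj⟩) (σ.branch v) := σ.rel (Sym2.mem_mk_left v w)
  have hrelw : f.Rel (σ.sub ⟨s(v, w), hadj⟩) (σ.branch w) := σ.rel (Sym2.mem_mk_right v w)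
  exact hvw (σ.branch.injective (hrelv.eq_of_layer_eq hrelw (hv.trans hw.symm)))

theorem IsSparse.card_le_mul_indepNum_of_model (hf : f.IsSparse)
    (hn : ∀ i < K, 10 * n (i + 1) ≤ n i) [Finite W] (σ : SubdivisionModel H f.Rel) :
    Nat.card W ≤ 8 * H.indepNum := by
  classical
  have := Fintype.ofFinite W
  rw [Nat.card_eq_fintype_card]
  have hW : Fintype.card W ≤ 10 * n 0 := by
    have := Fintype.card_le_of_embedding σ.branch
    rw [Fintype.card_fin] at this
    omega
  obtain ⟨j, hjK, hsmall, hlarge⟩ := exists_scale hn hW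
  have hbelow : #{e | (σ.sub e).1.val < j} ≤ 2 * Fintype.card W :=
    (hf j hjK).1.card_le hsmall σ.branch σ.sub fun e he _ hv =>
      ⟨(mem_filter_univ e).1 he, σ.rel hv⟩
  have hat := card_filter_layer_eq_le σ j
  have habove := card_filter_lt_layer_le σ.sub j
  have hedges := card_filter_lt_add_card_filter_eq_add_card_filter_gt univ
    (fun e => (σ.sub e).1.val) j
  rw [card_univ, ← edgeFinset_card] at hedges
  -- The layers before, at and after the `j`-th contribute at most `2 + 1 + 1 / 9 = 28 / 9` edges
  -- per vertex.
  have := mul_card_le_mul_indepNum H (p := 28) (q := 9) (by omega)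
  omega

theorem IsSparse.card_le_mul_indepNum_of_model_flip (hf : f.IsSparse)
    (hn : ∀ i < K, 10 * n (i + 1) ≤ n i) [Finite W] (σ : SubdivisionModel H (flip f.Rel)) :
    Nat.card W ≤ 8 * H.indepNum := by
  classical
  have := Fintype.ofFinite W
  rw [Nat.card_eq_fintype_card]
  have hW : Fintype.card W ≤ 10 * n 0 := by
    have := (Fintype.card_le_of_embedding σ.branch).trans (card_layerVertex_le hn)
    omega
  obtain ⟨j, hjK, hsmall, hlarge⟩ := exists_scale hn hW
  have hbelow : #{v | (σ.branch v).1.val < j} ≤ 5 * H.indepNum := by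
    set s : Set W := {v | (σ.branch v).1.val < j}
    have hs : #{v | (σ.branch v).1.val < j} = Fintype.card s := by simp [s, Fintype.card_subtype]
    have hedges : #(H.induce s).edgeFinset ≤ 2 * Fintype.card s := by
      rw [edgeFinset_card, ← card_univ]
      exact (hf j hjK).2.card_le ((set_fintype_card_le_univ s).trans hsmall)
        (σ.induce s).branch (σ.induce s).sub fun e _ v hv => ⟨v.2, (σ.induce s).rel hv⟩
    have := mul_card_le_mul_indepNum (H.induce s) (p := 2) (q := 1) (by omega)
    have := indepNum_induce_le H s
    omega
  have hat : #{v | (σ.branch v).1.val = j} ≤ H.indepNum :=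
    IsIndepSet.card_le_indepNum (by simpa using isIndepSet_layer_eq σ j)
  have habove := card_filter_lt_layer_le σ.branch j
  have hcard := card_filter_lt_add_card_filter_eq_add_card_filter_gt univ
    (fun v => (σ.branch v).1.val) j
  rw [card_univ] at hcard
  omega

end LayerChoice

end Layers

theorem theorem2_general (d : ℕ) :
    ∃ (V : Type) (_ : Fintype V) (G : SimpleGraph V) (_ : DecidableRel G.Adj),
      G.IsBipartite ∧ (d : ℝ) ≤ G.averageDegree ∧
        ∀ (W : Type*) [Finite W] (H : SimpleGraph W),
          H.oneSubdivision.IsContained G → H.hallRatio ≤ 8 := by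
  classical
  set K := 3 * d
  set c := 4320 * (K + 1)
  set n := layerSize c K
  have hpos : ∀ i, 0 < n i := layerSize_pos (by omega) K
  have hdec : ∀ i < K, 10 * n (i + 1) ≤ n i := fun i hi =>
    (Nat.mul_le_mul_right _ (by omega)).trans (mul_layerSize_succ_le (by omega) hi)
  obtain ⟨f, hf⟩ := LayerChoice.exists_isSparse hpos (layerSize_antitone (by omega) K) hdec
    fun i hi => mul_layerSize_succ_mul_pow_le (by omega) hi
  refine ⟨_, inferInstance, relGraph f.Rel, inferInstance, isBipartite_relGraph _, ?_, ?_⟩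
  · have hdegree := f.le_three_mul_averageDegree (hpos 0) hdec
    have hcast : (K : ℝ) = 3 * d := by simp [K]
    linarith
  · intro W _ H hH
    refine mod_cast hallRatio_le_of_forall_card_le (c := 8) (fun L hL => ?_) hH
    exact card_le_mul_indepNum_of_isContained
      (fun s σ => hf.card_le_mul_indepNum_of_model hdec σ)
      (fun s σ => hf.card_le_mul_indepNum_of_model_flip hdec σ) hL

/-- For every `d ≥ 1` there is a finite bipartite graph of average degree at least `d` such that no
graph whose `1`-subdivision is isomorphic to a subgraph of it has Hall ratio greater than `18`. -/
theorem theorem2 (d : ℕ) (hd : 1 ≤ d) :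
    ∃ (V : Type) (_ : Fintype V) (G : SimpleGraph V) (_ : DecidableRel G.Adj),
      G.IsBipartite ∧ (d : ℝ) ≤ G.averageDegree ∧
        ∀ (W : Type*) [Finite W] (H : SimpleGraph W),
          18 < H.hallRatio → ¬ H.oneSubdivision.IsContained G := by
  obtain ⟨V, _, G, _, hbip, hdegree, hhall⟩ := theorem2_general d
  exact ⟨V, _, G, _, hbip, hdegree, fun W _ H hH h => by linarith [hhall W H h]⟩
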